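/- All graphs are finite, simple and undirected. For a graph $G$ without isolated vertices, a total dominating set is a set $S\subseteq V(G)$ such that every vertex of $G$ is adjacent to at least one vertex of $S$, and the total domination number $\gamma_t(G)$ is the minimum cardinality of a total dominating set. For an integer $k\ge 0$, the $k$-total bondage number $b_t^k(G)$ is the minimum size of a set $D\subseteq E(G)$ of edges such that $G\setminus D$ (the graph on the same vertices with the edges in $D$ deleted) has no isolated vertices and $\gamma_t(G\setminus D)\ge \gamma_t(G)+k$. Theorem. Let $n\ge 5$ and let $k\ge 0$ be an integer, with $k\le n-2$ if $k$ is even and $k\le n-4$ if $k$ is odd. Then such a set $D$ exists for the complete graph $K_n$, and $$b_t^k(K_n)=\begin{cases} nk-\dfrac{k^2+2k}{2}, & k \text{ even},\\[2mm] nk+n-\dfrac{k^2+4k+5}{2}, & k \text{ odd}.\end{cases}$$ -/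

import Mathlib

namespace TotalBondage

/-- `S` is a total dominating set of `G`: every vertex of `G` (also those in `S`) is adjacent to at
least one vertex of `S`. -/
def IsTotalDominatingSet {V : Type*} (G : SimpleGraph V) (S : Finset V) : Prop :=
  ∀ v : V, ∃ u ∈ S, G.Adj v u

/-- `G` has no isolated vertices. -/
def NoIsolatedVertices {V : Type*} (G : SimpleGraph V) : Prop :=
  ∀ v : V, ¬ G.IsIsolated v

/-- The total domination number: the minimum cardinality of a total dominating set. On a finite
vertex set the minimum is attained as soon as `G` has no isolated vertices; it is only used for
such graphs. -/
noncomputable def totalDominationNumber {V : Type*} (G : SimpleGraph V) : ℕ :=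
  sInf {m : ℕ | ∃ S : Finset V, IsTotalDominatingSet G S ∧ S.card = m}

/-- The numbers `m` such that some `m` edges of `G` can be deleted, without creating an isolated
vertex, so that the total domination number increases by at least `k`. -/
def kTotalBondageSizes {V : Type*} (G : SimpleGraph V) (k : ℕ) : Set ℕ :=
  {m : ℕ | ∃ D : Finset (Sym2 V), (D : Set (Sym2 V)) ⊆ G.edgeSet ∧ D.card = m ∧
    NoIsolatedVertices (G.deleteEdges (D : Set (Sym2 V))) ∧
    totalDominationNumber G + k ≤ totalDominationNumber (G.deleteEdges (D : Set (Sym2 V)))}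

/-- The `k`-total bondage number of `G`, the least element of `kTotalBondageSizes G k`
(meaningful when that set is nonempty). -/
noncomputable def kTotalBondageNumber {V : Type*} (G : SimpleGraph V) (k : ℕ) : ℕ :=
  sInf (kTotalBondageSizes G k)

end TotalBondage

/-!
Deleting edges from `K_n` leaves an arbitrary graph `H`, and `γ_t(K_n) = 2`. The theorem therefore
asks for the largest number of edges of a graph `H` on `n` vertices without isolated vertices and
with `γ_t(H) ≥ t`, where `t = k + 2`.

**Upper bound, even `t`** (`adjCount_le_of_needsDominators`). The statement is proved for a set `R`
of `t + r` vertices that needs `t` dominators, taken anywhere in the graph. Take `v ∈ R` of maximum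
degree `d` inside `R`, with neighbours `N` and non-neighbours `S`. An edge `vu` dominates all of
`R` except the part of `S` not adjacent to `u`. Hence every `u ∈ N` has at most `x = r + 1 - d`
neighbours in `S`, and `S` needs `t - 2` dominators. Induction bounds the edges in `S`, and the sum
of the degrees is at most `d + d ^ 2 + d x + 2 e(S)`.

**Upper bound, odd `t`** (`adjCount_le_of_odd`). This bound is stronger; it holds for unions `R` of
components, where the absence of isolated vertices can be used. Let `v`, `d`, `N`, `S`, `x` be as
before.
* If no edge joins `N` and `S`, then `S` is again a union of components and induction applies.
* If `x ≥ 2` and `u ∈ N` has the largest number `a ≥ 1` of neighbours in `S`, the neighbours of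
  `u` in `S` and the rest of `S` are counted separately, the rest by the previous bound
  (`adjCount_nonneighbors_le`).
* If `x = 1` (`adjCount_le_of_tight`), the graph on `S` is a matching and each vertex of `N` has at
  most one neighbour in `S`. Let `M` be the set of those which have one, and let `F` be the graph
  of non-adjacent pairs in `N`. Two vertices of `M` with different neighbours in `S` are at
  distance at most two in `F`, since otherwise they would be adjacent and dominate too much. So, if
  two different neighbours in `S` occur, `M` lies in one component of `F`; if only one occurs, each
  vertex of `M` has an `F`-neighbour outside `M`. Either way `|M| ≤ e(F) + 1`, which is the
  required inequality (`two_mul_card_attached_le`). For `t = 3`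
  this is the bound `2 n - 5` for the number of edges of a graph of diameter two, here the
  complement of `H`, in which no vertex is adjacent to all others.

**Lower bound.** A clique (`realizable_complete`) or, for odd `t`, a 5-cycle with one vertex
replaced by a clique (`realizable_cycleClique`) is extremal for `t = 2` and `t = 3`, and each
additional disjoint edge raises `t` by two (`Realizable.add_edge`).
-/

namespace TotalBondage

open Finset

/-! ### Notions -/

open scoped Classical in
/-- The number of neighbours of `a` in the vertex set `B`. -/
noncomputable def degIn {V : Type*} (G : SimpleGraph V) (B : Finset V) (a : V) : ℕ :=
  #{b ∈ B | G.Adj a b}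

/-- The number of ordered pairs `(a, b)` of adjacent vertices with `a ∈ A` and `b ∈ B`. In
particular `adjCount G R R` is twice the number of edges inside `R`. -/
noncomputable def adjCount {V : Type*} (G : SimpleGraph V) (A B : Finset V) : ℕ :=
  ∑ a ∈ A, degIn G B a

/-- At least `p` vertices of `G` are needed to totally dominate the vertex set `R`. The
dominating vertices may lie outside `R`. -/
def NeedsDominators {V : Type*} (G : SimpleGraph V) (R : Finset V) (p : ℕ) : Prop :=
  ∀ D : Finset V, (∀ w ∈ R, ∃ y ∈ D, G.Adj w y) → p ≤ #D

/-! ### Counting adjacent pairs -/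

section Counting

variable {V : Type*} {G : SimpleGraph V}

lemma degIn_pos_iff {B : Finset V} {a : V} : 0 < degIn G B a ↔ ∃ b ∈ B, G.Adj a b := by
  classical
  simp [degIn, Finset.card_pos, Finset.Nonempty]

lemma degIn_eq_zero_iff {B : Finset V} {a : V} : degIn G B a = 0 ↔ ∀ b ∈ B, ¬ G.Adj a b := by
  classical
  simp [degIn, Finset.filter_eq_empty_iff]

lemma one_lt_degIn {B : Finset V} {a b c : V} (hb : b ∈ B) (hc : c ∈ B) (hbc : b ≠ c)
    (hab : G.Adj a b) (hac : G.Adj a c) : 1 < degIn G B a := by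
  classical
  exact Finset.one_lt_card.2 ⟨b, by simp [hb, hab], c, by simp [hc, hac], hbc⟩

lemma degIn_union [DecidableEq V] {A B : Finset V} (h : Disjoint A B) (a : V) :
    degIn G (A ∪ B) a = degIn G A a + degIn G B a := by
  classical
  unfold degIn
  rw [Finset.filter_union, Finset.card_union_of_disjoint]
  exact Finset.disjoint_filter_filter h

lemma degIn_mono {A B : Finset V} (h : A ⊆ B) (a : V) : degIn G A a ≤ degIn G B a := by
  classical
  exact Finset.card_le_card (Finset.filter_subset_filter _ h)

lemma degIn_add_one_le {B : Finset V} {a : V} (ha : a ∈ B) : degIn G B a + 1 ≤ #B := by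
  classical
  have : degIn G B a < #B := Finset.card_lt_card <| by
    refine Finset.filter_ssubset.2 ⟨a, ha, G.loopless.irrefl a⟩
  omega

lemma adjCount_comm (A B : Finset V) : adjCount G A B = adjCount G B A := by
  classical
  have := Finset.sum_card_bipartiteAbove_eq_sum_card_bipartiteBelow (s := A) (t := B) G.Adj
  simpa [adjCount, degIn, Finset.bipartiteAbove, Finset.bipartiteBelow, G.adj_comm] using this

lemma adjCount_union_left [DecidableEq V] {A B : Finset V} (h : Disjoint A B) (C : Finset V) :
    adjCount G (A ∪ B) C = adjCount G A C + adjCount G B C :=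
  Finset.sum_union h

lemma adjCount_union_right [DecidableEq V] {A B : Finset V} (h : Disjoint A B) (C : Finset V) :
    adjCount G C (A ∪ B) = adjCount G C A + adjCount G C B := by
  rw [adjCount_comm, adjCount_union_left h, adjCount_comm, adjCount_comm B]

lemma adjCount_union_self [DecidableEq V] {A B : Finset V} (h : Disjoint A B) :
    adjCount G (A ∪ B) (A ∪ B) = adjCount G A A + 2 * adjCount G A B + adjCount G B B := by
  rw [adjCount_union_left h, adjCount_union_right h, adjCount_union_right h, adjCount_comm B A]
  ring

lemma adjCount_le_mul {A B : Finset V} {c : ℕ} (h : ∀ a ∈ A, degIn G B a ≤ c) :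
    adjCount G A B ≤ #A * c := by
  simpa [adjCount] using Finset.sum_le_card_nsmul A _ c h

lemma adjCount_self_le (A : Finset V) : adjCount G A A ≤ #A * (#A - 1) :=
  adjCount_le_mul fun a ha => by have := degIn_add_one_le (G := G) ha; omega

lemma adjCount_singleton_self (a : V) : adjCount G {a} {a} = 0 := by
  simpa using adjCount_self_le (G := G) {a}

lemma even_adjCount_self (A : Finset V) : Even (adjCount G A A) := by
  classical
  induction A using Finset.induction_on with
  | empty => simp [adjCount]
  | insert a s ha ih =>
    rw [Finset.insert_eq, adjCount_union_self (by simpa using ha), adjCount_singleton_self]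
    rw [zero_add]
    exact (even_two_mul _).add ih

/-- A vertex set of odd size all of whose inner degrees are at most one has an inner isolated
vertex. -/
lemma exists_degIn_eq_zero {A : Finset V} (hA : Odd #A) (h : ∀ a ∈ A, degIn G A a ≤ 1) :
    ∃ a ∈ A, degIn G A a = 0 := by
  by_contra! hne
  have h1 : adjCount G A A = #A := by
    rw [adjCount, Finset.sum_congr rfl (g := fun _ => 1)]
    · simp
    · intro a ha
      have := h a ha
      have := hne a ha
      omega
  have := even_adjCount_self (G := G) A
  rw [h1] at this
  exact (Nat.not_even_iff_odd.2 hA) this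

/-- A vertex set `R` consists of a vertex `v`, its neighbours `N` and its non-neighbours `S`. -/
lemma eq_union_nonneighbors [DecidableEq V] {R N S : Finset V} {v : V} (hv : v ∈ R)
    (hN : ∀ a, a ∈ N ↔ a ∈ R ∧ G.Adj v a) (hS : ∀ a, a ∈ S ↔ a ∈ R ∧ a ≠ v ∧ ¬ G.Adj v a) :
    R = {v} ∪ (N ∪ S) ∧ Disjoint {v} (N ∪ S) ∧ Disjoint N S := by
  refine ⟨?_, by simp [hN, hS], ?_⟩
  · ext a
    simp only [Finset.mem_union, Finset.mem_singleton, hN, hS]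
    by_cases hav : a = v
    · simp [hav, hv]
    · tauto
  · rw [Finset.disjoint_left]
    intro a ha hb
    exact ((hS a).1 hb).2.2 ((hN a).1 ha).2

/-- Counting the degrees inside `R` around a vertex `v`: its neighbours `N` and its
non-neighbours `S` are counted separately. -/
lemma adjCount_self_eq [DecidableEq V] {R N S : Finset V} {v : V} (hv : v ∈ R)
    (hN : ∀ a, a ∈ N ↔ a ∈ R ∧ G.Adj v a) (hS : ∀ a, a ∈ S ↔ a ∈ R ∧ a ≠ v ∧ ¬ G.Adj v a) :
    adjCount G R R = #N + adjCount G N R + adjCount G N S + adjCount G S S := by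
  have hd : #N = degIn G R v := by
    unfold degIn
    congr 1
    ext a
    simp [hN]
  obtain ⟨hR, hvNS, hNS⟩ := eq_union_nonneighbors hv hN hS
  have hSR : adjCount G S R = adjCount G N S + adjCount G S S := by
    have hz : adjCount G S {v} = 0 := Finset.sum_eq_zero fun s hs =>
      degIn_eq_zero_iff.2 fun b hb hsb => by
        rw [Finset.mem_singleton] at hb
        subst hb
        exact ((hS s).1 hs).2.2 hsb.symm
    conv_lhs => rw [hR]
    rw [adjCount_union_right hvNS, adjCount_union_right hNS, hz, adjCount_comm S N]
    ring
  have hvR : adjCount G {v} R = #N := by simp [adjCount, hd]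
  have : adjCount G R R = adjCount G ({v} ∪ (N ∪ S)) R := by rw [← hR]
  rw [this, adjCount_union_left hvNS, adjCount_union_left hNS, hvR, hSR]
  ring

end Counting

/-! ### Sets that need many dominators -/

section Domination

variable {V : Type*} {G : SimpleGraph V}

/-- Part `R \ Q` of a set being dominated by the vertices of `Y`, the rest `Q` still needs the
remaining dominators. -/
lemma NeedsDominators.of_dominated {R Q Y : Finset V} {p c : ℕ} (h : NeedsDominators G R p)
    (hY : #Y ≤ c) (hQ : ∀ w ∈ R, w ∉ Q → ∃ y ∈ Y, G.Adj w y) : NeedsDominators G Q (p - c) := by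
  classical
  intro D hD
  have := h (Y ∪ D) fun w hw => by
    by_cases hwQ : w ∈ Q
    · obtain ⟨y, hy, hwy⟩ := hD w hwQ
      exact ⟨y, by simp [hy], hwy⟩
    · obtain ⟨y, hy, hwy⟩ := hQ w hw hwQ
      exact ⟨y, by simp [hy], hwy⟩
  have := Finset.card_union_le Y D
  omega

lemma NeedsDominators.le_card (hG : ∀ v, ∃ u, G.Adj v u) {R : Finset V} {p : ℕ}
    (h : NeedsDominators G R p) : p ≤ #R := by
  classical
  choose f hf using hG
  exact (h (R.image f) fun w hw => ⟨f w, Finset.mem_image_of_mem f hw, hf w⟩).trans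
    Finset.card_image_le

lemma NeedsDominators.le_add_card (hG : ∀ v, ∃ u, G.Adj v u) {R Q Y : Finset V} {p c : ℕ}
    (h : NeedsDominators G R p) (hY : #Y ≤ c) (hQ : ∀ w ∈ R, w ∉ Q → ∃ y ∈ Y, G.Adj w y) :
    p ≤ c + #Q := by
  have := NeedsDominators.le_card hG (h.of_dominated hY hQ)
  omega

lemma NeedsDominators.degIn_add_le (hG : ∀ v, ∃ u, G.Adj v u) {R : Finset V} {p : ℕ}
    (h : NeedsDominators G R p) (y : V) :
    degIn G R y + p ≤ #R + 1 := by
  classical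
  have h1 := NeedsDominators.le_add_card hG h (Y := {y}) (c := 1)
    (Q := {b ∈ R | ¬ G.Adj y b}) (by simp)
    fun w hw hwQ => ⟨y, by simp, by
      simp only [Finset.mem_filter, not_and, not_not] at hwQ
      exact (hwQ hw).symm⟩
  have h2 := Finset.card_filter_add_card_filter_not (s := R) (fun b => G.Adj y b)
  unfold degIn
  omega

end Domination

/-! ### Upper bound for arbitrary vertex sets -/

section UpperBound

variable {V : Type*} {G : SimpleGraph V}

/-- An edge `vu` inside `R` dominates everything but the non-neighbours of `u` among the
non-neighbours of `v`; hence `u` has few neighbours among the latter. -/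
lemma degIn_add_le_of_adj (hG : ∀ v, ∃ u, G.Adj v u) {R S : Finset V} {p : ℕ} {u v : V}
    (h : NeedsDominators G R p) (hvu : G.Adj v u)
    (hS : ∀ a, a ∈ S ↔ a ∈ R ∧ a ≠ v ∧ ¬ G.Adj v a) : degIn G S u + p ≤ #S + 2 := by
  classical
  have h1 := NeedsDominators.le_add_card hG h (Y := {v, u}) (c := 2)
    (Q := {b ∈ S | ¬ G.Adj u b}) Finset.card_le_two fun w hw hwQ => by
      by_cases hwv : w = v
      · exact ⟨u, by simp, hwv ▸ hvu⟩
      by_cases hwa : G.Adj v w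
      · exact ⟨v, by simp, hwa.symm⟩
      refine ⟨u, by simp, ?_⟩
      simp only [Finset.mem_filter, hS, not_and, not_not] at hwQ
      exact (hwQ ⟨hw, hwv, hwa⟩).symm
  have h2 := Finset.card_filter_add_card_filter_not (s := S) (fun b => G.Adj u b)
  unfold degIn
  omega

/-- An edge `vu` inside `R` costs two dominators and leaves only non-neighbours of `v` to be
dominated. -/
lemma NeedsDominators.nonneighbors {R S : Finset V} {p : ℕ} {u v : V}
    (h : NeedsDominators G R p) (hvu : G.Adj v u)
    (hS : ∀ a, a ∈ S ↔ a ∈ R ∧ a ≠ v ∧ ¬ G.Adj v a) : NeedsDominators G S (p - 2) := by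
  classical
  refine h.of_dominated (Y := {v, u}) Finset.card_le_two fun w hw hwS => ?_
  by_cases hwv : w = v
  · exact ⟨u, by simp, hwv ▸ hvu⟩
  by_cases hwa : G.Adj v w
  · exact ⟨v, by simp, hwa.symm⟩
  exact absurd ((hS w).2 ⟨hw, hwv, hwa⟩) hwS

lemma card_eq_add_card_nonneighbors {R N S : Finset V} {v : V} (hv : v ∈ R)
    (hN : ∀ a, a ∈ N ↔ a ∈ R ∧ G.Adj v a) (hS : ∀ a, a ∈ S ↔ a ∈ R ∧ a ≠ v ∧ ¬ G.Adj v a) :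
    #R = 1 + #N + #S := by
  classical
  obtain ⟨hR, hvNS, hNS⟩ := eq_union_nonneighbors hv hN hS
  rw [hR, Finset.card_union_of_disjoint hvNS, Finset.card_union_of_disjoint hNS,
    Finset.card_singleton]
  ring

lemma card_neighbors_eq_degIn {R N : Finset V} {v : V} (hN : ∀ a, a ∈ N ↔ a ∈ R ∧ G.Adj v a) :
    #N = degIn G R v := by
  classical
  unfold degIn
  congr 1
  ext a
  simp [hN]

/-- A vertex set of size `p + r` that needs `p` dominators spans at most
`r (r + 3) / 2 + ⌊p / 2⌋` edges. The bound is attained by a clique on `r + 2` vertices together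
with disjoint edges. -/
theorem adjCount_le_of_needsDominators (hG : ∀ v, ∃ u, G.Adj v u) (R : Finset V) :
    ∀ p r : ℕ, #R = p + r → NeedsDominators G R p →
      adjCount G R R ≤ r * (r + 3) + 2 * (p / 2) := by
  classical
  induction R using Finset.strongInduction with
  | H R ih =>
  intro p r hR hp
  rcases Nat.lt_or_ge p 2 with hp2 | hp2
  · have h1 := adjCount_self_le (G := G) R
    have h2 : #R * (#R - 1) ≤ r * (r + 3) := by
      rcases (by omega : p = 0 ∨ p = 1) with h | h <;> subst h <;> rw [hR]
      · exact Nat.mul_le_mul (by omega) (by omega)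
      · rw [mul_comm]; exact Nat.mul_le_mul (by omega) (by omega)
    omega
  rcases R.eq_empty_or_nonempty with rfl | hne
  · simp [adjCount]
  obtain ⟨v, hv, hmax⟩ := Finset.exists_max_image R (degIn G R) hne
  set d := degIn G R v with hd
  rcases Nat.lt_or_ge d 2 with hd2 | hd2
  · have h1 : adjCount G R R ≤ #R * 1 := adjCount_le_mul fun a ha => by have := hmax a ha; omega
    obtain ⟨c, hc⟩ := even_adjCount_self (G := G) R
    rcases Nat.eq_zero_or_pos r with rfl | hr
    · omega
    · have : r + 3 ≤ r * (r + 3) := Nat.le_mul_of_pos_left _ hr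
      omega
  set N := {a ∈ R | G.Adj v a} with hNdef
  set S := {a ∈ R | a ≠ v ∧ ¬ G.Adj v a} with hSdef
  have hN : ∀ a, a ∈ N ↔ a ∈ R ∧ G.Adj v a := fun a => by simp [hNdef]
  have hS : ∀ a, a ∈ S ↔ a ∈ R ∧ a ≠ v ∧ ¬ G.Adj v a := fun a => by simp [hSdef]
  have hNd : #N = d := card_neighbors_eq_degIn hN
  have hcard := card_eq_add_card_nonneighbors hv hN hS
  obtain ⟨u, hu⟩ : N.Nonempty := Finset.card_pos.1 (by omega)
  have hd1 : d + p ≤ #R + 1 := NeedsDominators.degIn_add_le hG hp v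
  obtain ⟨x, hx⟩ : ∃ x, x + d = r + 1 := ⟨r + 1 - d, by omega⟩
  have hSS := ih S (Finset.filter_ssubset.2 ⟨v, hv, by simp⟩) (p - 2) x (by omega)
    (hp.nonneighbors ((hN u).1 hu).2 hS)
  have hNS : adjCount G N S ≤ #N * x := adjCount_le_mul fun a ha => by
    have := degIn_add_le_of_adj hG hp ((hN a).1 ha).2 hS
    omega
  have hNR : adjCount G N R ≤ #N * d := adjCount_le_mul fun a ha => hmax a ((hN a).1 ha).1
  rw [adjCount_self_eq hv hN hS]
  obtain ⟨e, he⟩ : ∃ e, d = e + 2 := ⟨d - 2, by omega⟩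
  rw [hNd, he] at hNS hNR
  rw [hNd, he]
  have hr : r = x + e + 1 := by omega
  have : 2 * (p / 2) = 2 * ((p - 2) / 2) + 2 := by omega
  rw [this, hr]
  nlinarith [Nat.zero_le (x * e)]

end UpperBound

/-! ### Edges of a graph with a large component -/

section Connectivity

variable {V : Type*}

lemma adjCount_univ [Fintype V] (F : SimpleGraph V) [Fintype F.edgeSet] :
    adjCount F univ univ = 2 * #F.edgeFinset := by
  classical
  have h : adjCount F univ univ = ∑ v, F.degree v := by
    refine Finset.sum_congr rfl fun v _ => ?_
    rw [← F.card_neighborFinset_eq_degree]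
    unfold degIn
    congr 1
    ext b
    simp
  rw [h, F.sum_degrees_eq_twice_card_edges]
  congr!

/-- A set of vertices lying in one component of a graph `F` has size at most one more than the
number of edges of `F`. -/
lemma two_mul_card_le_of_reachable [Fintype V] {F : SimpleGraph V} {A : Finset V}
    (hA : ∀ a ∈ A, ∀ b ∈ A, F.Reachable a b) :
    2 * #A ≤ adjCount F univ univ + 2 := by
  classical
  rcases A.eq_empty_or_nonempty with rfl | ⟨a, ha⟩
  · simp
  have h2 := adjCount_univ F
  set C := F.connectedComponentMk a with hC
  have h3 := (C.connected_toSimpleGraph).card_vert_le_card_edgeSet_add_one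
  have h4 : #A ≤ Nat.card C := by
    rw [← Nat.card_eq_finsetCard]
    refine Nat.card_le_card_of_injective (fun b : A => (⟨b.1, ?_⟩ : C)) fun b c hbc => ?_
    · exact SimpleGraph.ConnectedComponent.sound (hA b.1 b.2 a ha)
    · exact Subtype.ext (congrArg (fun c : C => c.1) hbc)
  have h5 : Nat.card C.toSimpleGraph.edgeSet ≤ #F.edgeFinset := by
    rw [SimpleGraph.edgeFinset_card, ← Nat.card_eq_fintype_card]
    exact Nat.card_le_card_of_injective _
      (SimpleGraph.Hom.mapEdgeSet.injective C.toSimpleGraph_hom Subtype.val_injective)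
  omega

end Connectivity

/-! ### Splitting the non-neighbours of a vertex of maximum degree -/

section UpperBound

variable {V : Type*} {G : SimpleGraph V}

/-- If some neighbour `u` of `v` has `a ≥ 1` neighbours in `S` and all have at most `a`, the set
`S` is split into the neighbours of `u` and the rest, which still needs `p - 2` dominators. -/
lemma adjCount_nonneighbors_le (hG : ∀ v, ∃ u, G.Adj v u) {R S : Finset V} {p a r : ℕ} {u v : V}
    (h : NeedsDominators G R (p + 2)) (hvu : G.Adj v u)
    (hS : ∀ a, a ∈ S ↔ a ∈ R ∧ a ≠ v ∧ ¬ G.Adj v a) (ha : degIn G S u = a)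
    (hcard : #S = p + r + a) :
    adjCount G S S ≤ a * (a - 1) + 2 * (a * (r + 1)) + (r * (r + 3) + 2 * (p / 2)) := by
  classical
  set A := {b ∈ S | G.Adj u b} with hA
  set Q := {b ∈ S | ¬ G.Adj u b} with hQ
  have hAQ : Disjoint A Q := Finset.disjoint_filter_filter_not _ _ _
  have hSAQ : S = A ∪ Q := (Finset.filter_union_filter_not_eq _ _).symm
  have hAa : #A = a := by
    rw [← ha]
    unfold degIn
    congr 1
  have hQc : #Q = p + r := by
    have := Finset.card_union_of_disjoint hAQ
    rw [← hSAQ] at this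
    omega
  have hQn : NeedsDominators G Q p := by
    refine h.of_dominated (c := 2) (Y := {v, u}) Finset.card_le_two fun w hw hwQ => ?_
    by_cases hwv : w = v
    · exact ⟨u, by simp, hwv ▸ hvu⟩
    by_cases hwa : G.Adj v w
    · exact ⟨v, by simp, hwa.symm⟩
    refine ⟨u, by simp, ?_⟩
    simp only [hQ, Finset.mem_filter, hS, not_and, not_not] at hwQ
    exact (hwQ ⟨hw, hwv, hwa⟩).symm
  have h1 := adjCount_le_of_needsDominators hG Q p r hQc hQn
  have h2 : adjCount G A Q ≤ #A * (r + 1) := adjCount_le_mul fun b _ => by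
    have := NeedsDominators.degIn_add_le hG hQn b
    omega
  have h3 := adjCount_self_le (G := G) A
  rw [hAa] at h2 h3
  rw [hSAQ, adjCount_union_self hAQ]
  omega

/-- Suppose that the set `S` of non-neighbours of `v` has only one vertex more than the number
`2 i + 1` of dominators that it needs, and that some vertex of `S` is attached to a neighbour of
`v`. Then `S` spans a matching: otherwise it would contain a path on four vertices, which two
vertices dominate. -/
lemma degIn_nonneighbors_le_one (hG : ∀ v, ∃ u, G.Adj v u) {R S : Finset V} {i : ℕ} {u v t : V}
    (hclosed : ∀ x ∈ R, ∀ y, G.Adj x y → y ∈ R)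
    (h : NeedsDominators G R (2 * i + 3))
    (hS : ∀ a, a ∈ S ↔ a ∈ R ∧ a ≠ v ∧ ¬ G.Adj v a) (hcard : #S = 2 * i + 2)
    (hvu : G.Adj v u) (hut : G.Adj u t) (htS : t ∈ S) :
    ∀ s ∈ S, degIn G S s ≤ 1 := by
  classical
  -- removing from `S` a vertex attached to a neighbour of `v` leaves a matching
  have key : ∀ u t, G.Adj v u → G.Adj u t → t ∈ S → ∀ y, degIn G (S.erase t) y ≤ 1 := by
    intro u t hvu hut htS y
    have hn : NeedsDominators G (S.erase t) (2 * i + 1) := by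
      refine h.of_dominated (c := 2) (Y := {v, u}) Finset.card_le_two fun w hw hwQ => ?_
      by_cases hwv : w = v
      · exact ⟨u, by simp, hwv ▸ hvu⟩
      by_cases hwa : G.Adj v w
      · exact ⟨v, by simp, hwa.symm⟩
      have hwt : w = t := by
        by_contra hne
        exact hwQ (Finset.mem_erase.2 ⟨hne, (hS w).2 ⟨hw, hwv, hwa⟩⟩)
      exact ⟨u, by simp, hwt ▸ hut.symm⟩
    have := NeedsDominators.degIn_add_le hG hn y
    rw [Finset.card_erase_of_mem htS] at this
    omega
  intro s hs
  by_contra! hs2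
  obtain ⟨y, hy, z', hz', hyz'⟩ := Finset.one_lt_card.1 hs2
  simp only [Finset.mem_filter] at hy hz'
  have hadj : ∀ u t, G.Adj v u → G.Adj u t → t ∈ S → G.Adj s t := by
    intro u t hvu hut htS
    by_contra hst
    have h1 := key u t hvu hut htS s
    have h2 : 1 < degIn G (S.erase t) s := one_lt_degIn (b := y) (c := z')
      (Finset.mem_erase.2 ⟨by rintro rfl; exact hst hy.2, hy.1⟩)
      (Finset.mem_erase.2 ⟨by rintro rfl; exact hst hz'.2, hz'.1⟩) hyz' hy.2 hz'.2
    omega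
  have hst := hadj u t hvu hut htS
  obtain ⟨y, hyS, hsy, hyt⟩ : ∃ y ∈ S, G.Adj s y ∧ y ≠ t := by
    by_cases hyt : y = t
    · exact ⟨z', hz'.1, hz'.2, fun h => hyz' (hyt.trans h.symm)⟩
    · exact ⟨y, hy.1, hy.2, hyt⟩
  have hsE : s ∈ S.erase t := Finset.mem_erase.2 ⟨hst.ne, hs⟩
  have hyE : y ∈ S.erase t := Finset.mem_erase.2 ⟨hyt, hyS⟩
  obtain ⟨z, hzE, hz⟩ := exists_degIn_eq_zero (G := G) (A := S.erase t)
    (by rw [Finset.card_erase_of_mem htS]; exact ⟨i, by omega⟩) fun a _ => key u t hvu hut htS a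
  rw [degIn_eq_zero_iff] at hz
  have hzS := Finset.mem_of_mem_erase hzE
  obtain ⟨hzR, hzv, hvz⟩ := (hS z).1 hzS
  -- the only possible neighbour of `z` is `t`, so that `y`, `s`, `t`, `z` form a path
  have hzt : G.Adj z t := by
    obtain ⟨b, hzb⟩ := hG z
    have hbR := hclosed z hzR b hzb
    by_cases hbv : b = v
    · exact absurd (hbv ▸ hzb).symm hvz
    by_cases hvb : G.Adj v b
    · exact absurd (hadj b z hvb hzb.symm hzS).symm (hz s hsE)
    by_cases hbt : b = t
    · exact hbt ▸ hzb
    exact absurd hzb (hz b (Finset.mem_erase.2 ⟨hbt, (hS b).2 ⟨hbR, hbv, hvb⟩⟩))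
  have hzs : z ≠ s := by rintro rfl; exact hz y hyE hsy
  have hzy : z ≠ y := by rintro rfl; exact hz s hsE hsy.symm
  have hzt' : z ≠ t := hzt.ne
  have h4 : #({y, s, t, z} : Finset V) = 4 := by
    rw [Finset.card_insert_of_notMem, Finset.card_insert_of_notMem,
      Finset.card_insert_of_notMem, Finset.card_singleton]
    · simp [hzt'.symm]
    · simp [hst.ne, hzs.symm]
    · simp [hsy.ne.symm, hyt, hzy.symm]
  have h4S : ({y, s, t, z} : Finset V) ⊆ S := by
    intro a
    simp only [Finset.mem_insert, Finset.mem_singleton]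
    rintro (rfl | rfl | rfl | rfl) <;> assumption
  have h5 := Finset.card_sdiff_add_card_eq_card h4S
  have h6 := NeedsDominators.le_add_card hG h (Y := {v, u, s, t}) (c := 4)
    (Q := S \ {y, s, t, z}) Finset.card_le_four fun w hw hwQ => by
      by_cases hwv : w = v
      · exact ⟨u, by simp, hwv ▸ hvu⟩
      by_cases hwa : G.Adj v w
      · exact ⟨v, by simp, hwa.symm⟩
      have hwS := (hS w).2 ⟨hw, hwv, hwa⟩
      simp only [Finset.mem_sdiff, hwS, true_and, not_not, Finset.mem_insert,
        Finset.mem_singleton] at hwQ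
      rcases hwQ with rfl | rfl | rfl | rfl
      · exact ⟨s, by simp, hsy.symm⟩
      · exact ⟨t, by simp, hst⟩
      · exact ⟨s, by simp, hst.symm⟩
      · exact ⟨t, by simp, hzt⟩
  omega

end UpperBound

/-! ### Upper bound for unions of components -/

section UpperBound

variable {V : Type*} {G : SimpleGraph V}

/-- The non-adjacency graph on the vertex set `N`: its edges are the pairs of distinct vertices
of `N` that are not adjacent in `G`. -/
def complIn (G : SimpleGraph V) (N : Finset V) : SimpleGraph V where
  Adj a b := a ∈ N ∧ b ∈ N ∧ a ≠ b ∧ ¬ G.Adj a b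
  symm := ⟨fun _ _ h => ⟨h.2.1, h.1, h.2.2.1.symm, fun h' => h.2.2.2 h'.symm⟩⟩
  loopless := ⟨fun _ h => h.2.2.1 rfl⟩

lemma complIn_adj {N : Finset V} {a b : V} :
    (complIn G N).Adj a b ↔ a ∈ N ∧ b ∈ N ∧ a ≠ b ∧ ¬ G.Adj a b :=
  Iff.rfl

lemma degIn_add_degIn_complIn [Fintype V] {N : Finset V} {a : V} (ha : a ∈ N) :
    degIn G N a + degIn (complIn G N) univ a + 1 = #N := by
  classical
  have h : N = insert a
      ({b ∈ N | G.Adj a b} ∪ {b ∈ (univ : Finset V) | (complIn G N).Adj a b}) := by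
    ext b
    simp only [complIn_adj, Finset.mem_insert, Finset.mem_union, Finset.mem_filter, Finset.mem_univ,
      true_and, ha]
    by_cases hab : b = a
    · simp [hab, ha]
    · have : a ≠ b := fun h => hab h.symm
      tauto
  have hd : Disjoint {b ∈ N | G.Adj a b} {b ∈ (univ : Finset V) | (complIn G N).Adj a b} := by
    rw [Finset.disjoint_left]
    intro b hb hb'
    simp only [complIn_adj, Finset.mem_filter] at hb hb'
    exact hb'.2.2.2.2 hb.2
  have := congrArg Finset.card h
  rw [Finset.card_insert_of_notMem (by simp),
    Finset.card_union_of_disjoint hd] at this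
  unfold degIn
  exact this.symm

lemma card_le_adjCount_of_forall {F : SimpleGraph V} {A B : Finset V}
    (h : ∀ a ∈ A, ∃ b ∈ B, F.Adj a b) : #A ≤ adjCount F A B := by
  simpa [adjCount] using
    Finset.card_nsmul_le_sum A (degIn F B) 1 fun a ha => degIn_pos_iff.2 (h a ha)

/-- Suppose that the set `S` of non-neighbours of `v` has only one vertex more than the number
`2 i + 1` of dominators that it needs. The set `M` of those neighbours of `v` that have a
neighbour in `S` lies in one component of the non-adjacency graph `F` on the neighbours of `v`, or
each vertex of `M` has an `F`-neighbour outside `M`. In both cases `F` has at least `|M| - 1`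
edges. -/
lemma two_mul_card_attached_le [Fintype V] (hG : ∀ v, ∃ u, G.Adj v u) {R N S M : Finset V}
    {i : ℕ} {v : V} (hclosed : ∀ x ∈ R, ∀ y, G.Adj x y → y ∈ R)
    (h : NeedsDominators G R (2 * i + 3)) (hN : ∀ a, a ∈ N ↔ a ∈ R ∧ G.Adj v a)
    (hS : ∀ a, a ∈ S ↔ a ∈ R ∧ a ≠ v ∧ ¬ G.Adj v a) (hcard : #S = 2 * i + 2)
    (hNS1 : ∀ u ∈ N, degIn G S u ≤ 1) (hSS1 : ∀ s ∈ S, degIn G S s ≤ 1)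
    (hM : ∀ u, u ∈ M ↔ u ∈ N ∧ ∃ t ∈ S, G.Adj u t) :
    2 * #M ≤ adjCount (complIn G N) univ univ + 2 := by
  classical
  have hpair : ∀ a ∈ S, ∀ b ∈ S, a ≠ b → #(S \ {a, b}) = 2 * i := by
    intro a ha b hb hab
    have h1 : ({a, b} : Finset V) ⊆ S := by simp [Finset.insert_subset_iff, ha, hb]
    have := Finset.card_sdiff_add_card_eq_card h1
    rw [Finset.card_pair hab] at this
    omega
  by_cases hT : ∃ u₁ ∈ N, ∃ t₁ ∈ S, ∃ u₂ ∈ N, ∃ t₂ ∈ S, G.Adj u₁ t₁ ∧ G.Adj u₂ t₂ ∧ t₁ ≠ t₂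
  · -- vertices of `M` with different neighbours in `S` are joined by an `F`-path of length ≤ 2
    have step : ∀ u ∈ N, ∀ u' ∈ N, ∀ t ∈ S, ∀ t' ∈ S, G.Adj u t → G.Adj u' t' → t ≠ t' →
        (complIn G N).Reachable u u' := by
      intro u hu u' hu' t ht t' ht' hut hut' htt'
      have huu' : u ≠ u' := by
        rintro rfl
        have := hNS1 u hu
        have := one_lt_degIn ht ht' htt' hut hut'
        omega
      by_cases hadj : G.Adj u u'
      · by_contra hnr
        have hdom : ∀ n ∈ N, G.Adj n u ∨ G.Adj n u' := by
          intro n hn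
          by_contra! hno
          apply hnr
          have h1 : (complIn G N).Adj u n := ⟨hu, hn, by rintro rfl; exact hno.2 hadj,
            fun h => hno.1 h.symm⟩
          have h2 : (complIn G N).Adj n u' := ⟨hn, hu', by rintro rfl; exact hno.1 hadj.symm,
            hno.2⟩
          exact h1.reachable.trans h2.reachable
        have := NeedsDominators.le_add_card hG h (Y := {u, u'}) (c := 2) (Q := S \ {t, t'})
          Finset.card_le_two fun w hw hwQ => by
            by_cases hwv : w = v
            · exact ⟨u, by simp, hwv ▸ ((hN u).1 hu).2⟩
            by_cases hwa : G.Adj v w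
            · rcases hdom w ((hN w).2 ⟨hw, hwa⟩) with h | h
              exacts [⟨u, by simp, h⟩, ⟨u', by simp, h⟩]
            have hwS := (hS w).2 ⟨hw, hwv, hwa⟩
            simp only [Finset.mem_sdiff, hwS, true_and, not_not, Finset.mem_insert,
              Finset.mem_singleton] at hwQ
            rcases hwQ with rfl | rfl
            exacts [⟨u, by simp, hut.symm⟩, ⟨u', by simp, hut'.symm⟩]
        have := hpair t ht t' ht' htt'
        omega
      · exact SimpleGraph.Adj.reachable (G := complIn G N) ⟨hu, hu', huu', hadj⟩
    obtain ⟨u₁, hu₁, t₁, ht₁, u₂, hu₂, t₂, ht₂, h₁, h₂, h₁₂⟩ := hT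
    refine two_mul_card_le_of_reachable fun u hu u' hu' => ?_
    obtain ⟨hu, t, ht, hut⟩ := (hM u).1 hu
    obtain ⟨hu', t', ht', hut'⟩ := (hM u').1 hu'
    by_cases htt' : t = t'
    · subst htt'
      by_cases ht1 : t = t₁
      · have ht2 : t ≠ t₂ := ht1 ▸ h₁₂
        exact (step u hu u₂ hu₂ t ht t₂ ht₂ hut h₂ ht2).trans
          (step u' hu' u₂ hu₂ t ht t₂ ht₂ hut' h₂ ht2).symm
      · exact (step u hu u₁ hu₁ t ht t₁ ht₁ hut h₁ ht1).trans
          (step u' hu' u₁ hu₁ t ht t₁ ht₁ hut' h₁ ht1).symm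
    · exact step u hu u' hu' t ht t' ht' hut hut' htt'
  · push Not at hT
    have hF : ∀ u ∈ M, ∃ n ∈ Mᶜ, (complIn G N).Adj u n := by
      intro u huM
      obtain ⟨hu, t, ht, hut⟩ := (hM u).1 huM
      have huniq : ∀ u' ∈ N, ∀ t' ∈ S, G.Adj u' t' → t' = t := fun u' hu' t' ht' h' =>
        hT u' hu' t' ht' u hu t ht h' hut
      -- by parity `t` has a neighbour `z` in `S`
      obtain ⟨z, hzS, hzt⟩ : ∃ z ∈ S, G.Adj z t := by
        obtain ⟨z, hzE, hz⟩ := exists_degIn_eq_zero (G := G) (A := S.erase t)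
          (by rw [Finset.card_erase_of_mem ht]; exact ⟨i, by omega⟩)
          fun a ha => (degIn_mono (Finset.erase_subset _ _) a).trans
            (hSS1 a (Finset.mem_of_mem_erase ha))
        rw [degIn_eq_zero_iff] at hz
        obtain ⟨hzt, hzS⟩ := Finset.mem_erase.1 hzE
        obtain ⟨hzR, hzv, hvz⟩ := (hS z).1 hzS
        refine ⟨z, hzS, ?_⟩
        obtain ⟨b, hzb⟩ := hG z
        have hbR := hclosed z hzR b hzb
        by_cases hbv : b = v
        · exact absurd (hbv ▸ hzb).symm hvz
        by_cases hvb : G.Adj v b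
        · exact absurd (huniq b ((hN b).2 ⟨hbR, hvb⟩) z hzS hzb.symm) hzt
        by_cases hbt : b = t
        · exact hbt ▸ hzb
        exact absurd hzb (hz b (Finset.mem_erase.2 ⟨hbt, (hS b).2 ⟨hbR, hbv, hvb⟩⟩))
      by_contra! hno
      have hdom : ∀ n ∈ N, G.Adj n u ∨ G.Adj n t := by
        intro n hn
        by_contra! hnn
        refine hno n (Finset.mem_compl.2 fun hnM => ?_)
          ⟨hu, hn, by rintro rfl; exact hnn.2 hut, fun h => hnn.1 h.symm⟩
        obtain ⟨-, t', ht', hnt'⟩ := (hM n).1 hnM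
        exact hnn.2 (huniq n hn t' ht' hnt' ▸ hnt')
      have := NeedsDominators.le_add_card hG h (Y := {u, t}) (c := 2) (Q := S \ {t, z})
        Finset.card_le_two fun w hw hwQ => by
          by_cases hwv : w = v
          · exact ⟨u, by simp, hwv ▸ ((hN u).1 hu).2⟩
          by_cases hwa : G.Adj v w
          · rcases hdom w ((hN w).2 ⟨hw, hwa⟩) with h | h
            exacts [⟨u, by simp, h⟩, ⟨t, by simp, h⟩]
          have hwS := (hS w).2 ⟨hw, hwv, hwa⟩
          simp only [Finset.mem_sdiff, hwS, true_and, not_not, Finset.mem_insert,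
            Finset.mem_singleton] at hwQ
          rcases hwQ with rfl | rfl
          exacts [⟨u, by simp, hut.symm⟩, ⟨t, by simp, hzt⟩]
      have := hpair t ht z hzS hzt.ne.symm
      omega
    have h1 := card_le_adjCount_of_forall hF
    have h2 := adjCount_union_self (G := complIn G N) (disjoint_compl_right (a := M))
    rw [Finset.union_compl] at h2
    omega

/-- The bound of `adjCount_le_of_odd` when some vertex `v` has degree `d = m`, one below the largest
value `m + 1` that a degree inside `R` can have, and an edge joins its neighbours to its
non-neighbours. -/
lemma adjCount_le_of_tight [Fintype V] (hG : ∀ v, ∃ u, G.Adj v u) {R N S : Finset V} {i d : ℕ}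
    {u v t : V} (hclosed : ∀ x ∈ R, ∀ y, G.Adj x y → y ∈ R) (hv : v ∈ R)
    (h : NeedsDominators G R (2 * i + 3)) (hN : ∀ a, a ∈ N ↔ a ∈ R ∧ G.Adj v a)
    (hS : ∀ a, a ∈ S ↔ a ∈ R ∧ a ≠ v ∧ ¬ G.Adj v a) (hNd : #N = d) (hcard : #S = 2 * i + 2)
    (huN : u ∈ N) (htS : t ∈ S) (hut : G.Adj u t) :
    adjCount G R R ≤ d * d + d + 2 * i + 4 := by
  classical
  have hNS1 : ∀ u ∈ N, degIn G S u ≤ 1 := fun u hu => by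
    have := degIn_add_le_of_adj hG h ((hN u).1 hu).2 hS
    omega
  have hSS1 := degIn_nonneighbors_le_one hG hclosed h hS hcard ((hN u).1 huN).2 hut htS
  set M := {u ∈ N | ∃ t ∈ S, G.Adj u t} with hMdef
  have hM : ∀ u, u ∈ M ↔ u ∈ N ∧ ∃ t ∈ S, G.Adj u t := fun u => by simp [hMdef]
  have h1 := two_mul_card_attached_le hG hclosed h hN hS hcard hNS1 hSS1 hM
  have h2 : adjCount G N S ≤ #M := by
    rw [Finset.card_filter]
    refine Finset.sum_le_sum fun u hu => ?_
    split_ifs with hu'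
    · exact hNS1 u hu
    · by_contra! hpos
      exact hu' (degIn_pos_iff.1 hpos)
  have h3 : adjCount G S S ≤ #S * 1 := adjCount_le_mul hSS1
  obtain ⟨hR, hvNS, hNS⟩ := eq_union_nonneighbors hv hN hS
  have h4 : adjCount G N R + adjCount (complIn G N) N univ = d * d + adjCount G N S := by
    have : ∀ u ∈ N, degIn G R u + degIn (complIn G N) univ u = d + degIn G S u := by
      intro u hu
      have e1 := degIn_add_degIn_complIn (G := G) hu
      have e2 : degIn G {v} u = 1 := by
        unfold degIn
        rw [Finset.filter_singleton, if_pos ((hN u).1 hu).2.symm, Finset.card_singleton]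
      have e3 := degIn_union (G := G) hvNS u
      rw [← hR, degIn_union hNS, e2] at e3
      omega
    unfold adjCount
    rw [← Finset.sum_add_distrib, Finset.sum_congr rfl this, Finset.sum_add_distrib]
    simp [hNd]
  have h5 : adjCount (complIn G N) univ univ = adjCount (complIn G N) N univ := by
    refine (Finset.sum_subset (Finset.subset_univ N) fun a _ ha => ?_).symm
    exact degIn_eq_zero_iff.2 fun b _ hab => ha hab.1
  rw [adjCount_self_eq hv hN hS]
  omega

/-- Let `R` be a union of components of a graph without isolated vertices, and suppose that
`R` has `2 j + 1 + m` vertices and needs at least `2 j + 1` dominators. Then `m` is positive and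
`R` spans at most `(m (m + 1)) / 2 + j + 1` edges. -/
theorem adjCount_le_of_odd [Fintype V] (hG : ∀ v, ∃ u, G.Adj v u) (R : Finset V) :
    ∀ j m : ℕ, (∀ x ∈ R, ∀ y, G.Adj x y → y ∈ R) → #R = 2 * j + 1 + m →
      NeedsDominators G R (2 * j + 1) →
      1 ≤ m ∧ adjCount G R R ≤ m * m + m + 2 * j + 2 := by
  classical
  induction R using Finset.strongInduction with
  | H R ih =>
  intro j m hclosed hR hp
  obtain ⟨w, hw⟩ : R.Nonempty := Finset.card_pos.1 (by omega)
  rcases Nat.eq_zero_or_pos j with rfl | hj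
  · obtain ⟨w', hww'⟩ := hG w
    have h1 := Finset.one_lt_card.2 ⟨w, hw, w', hclosed w hw w' hww', hww'.ne⟩
    have h2 := adjCount_self_le (G := G) R
    have h3 : #R * (#R - 1) = m * m + m := by
      rw [hR]
      simp only [mul_zero, zero_add, add_tsub_cancel_left]
      ring
    omega
  obtain ⟨i, rfl⟩ : ∃ i, j = i + 1 := ⟨j - 1, by omega⟩
  have hp : NeedsDominators G R (2 * i + 3) := hp
  obtain ⟨v, hv, hmax⟩ := Finset.exists_max_image R (degIn G R) ⟨w, hw⟩
  obtain ⟨d, hd⟩ : ∃ d, d = degIn G R v := ⟨_, rfl⟩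
  rw [← hd] at hmax
  rcases Nat.lt_or_ge d 2 with hd2 | hd2
  · have h1 : adjCount G R R ≤ #R * 1 := adjCount_le_mul fun a ha => by have := hmax a ha; omega
    have h2 : #R ≤ adjCount G R R := card_le_adjCount_of_forall fun a ha => by
      obtain ⟨b, hab⟩ := hG a
      exact ⟨b, hclosed a ha b hab, hab⟩
    obtain ⟨c, hc⟩ := even_adjCount_self (G := G) R
    have hm : 1 ≤ m := by omega
    exact ⟨hm, by nlinarith⟩
  set N := {a ∈ R | G.Adj v a} with hNdef
  set S := {a ∈ R | a ≠ v ∧ ¬ G.Adj v a} with hSdef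
  have hN : ∀ a, a ∈ N ↔ a ∈ R ∧ G.Adj v a := fun a => by simp [hNdef]
  have hS : ∀ a, a ∈ S ↔ a ∈ R ∧ a ≠ v ∧ ¬ G.Adj v a := fun a => by simp [hSdef]
  have hNd : #N = d := (card_neighbors_eq_degIn hN).trans hd.symm
  have hcard := card_eq_add_card_nonneighbors hv hN hS
  have hNne : N.Nonempty := Finset.card_pos.1 (by omega)
  have hd1 : degIn G R v + (2 * i + 3) ≤ #R + 1 := NeedsDominators.degIn_add_le hG hp v
  obtain ⟨x, hx⟩ : ∃ x, x + d = m + 1 := ⟨m + 1 - d, by omega⟩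
  have hNx : ∀ a ∈ N, degIn G S a ≤ x := fun a ha => by
    have := degIn_add_le_of_adj hG hp ((hN a).1 ha).2 hS
    omega
  have hNR : adjCount G N R ≤ #N * d := adjCount_le_mul fun a ha => hmax a ((hN a).1 ha).1
  refine ⟨by omega, ?_⟩
  obtain ⟨e, he⟩ : ∃ e, d = e + 2 := ⟨d - 2, by omega⟩
  have hm : m = x + e + 1 := by omega
  obtain ⟨u, hu, humax⟩ := Finset.exists_max_image N (degIn G S) hNne
  have hNa : adjCount G N S ≤ #N * degIn G S u := adjCount_le_mul humax
  obtain ⟨a, ha⟩ : ∃ a, a = degIn G S u := ⟨_, rfl⟩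
  have hax : a ≤ x := ha ▸ hNx u hu
  rw [← ha] at hNa
  have hvu := ((hN u).1 hu).2
  rcases Nat.eq_zero_or_pos a with ha0 | ha0
  · -- no edge leaves the closed neighbourhood of `v`
    obtain ⟨hx1, hSS⟩ := ih S (Finset.filter_ssubset.2 ⟨v, hv, by simp⟩) i x
      (fun s hs y hsy => by
        obtain ⟨hsR, hsv, hvs⟩ := (hS s).1 hs
        refine (hS y).2 ⟨hclosed s hsR y hsy, ?_, fun hvy => ?_⟩
        · rintro rfl; exact hvs hsy.symm
        · have hyN := (hN y).2 ⟨hclosed s hsR y hsy, hvy⟩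
          have h0 : degIn G S y = 0 := by have := humax y hyN; omega
          exact degIn_eq_zero_iff.1 h0 s hs hsy.symm)
      (by omega) (hp.nonneighbors hvu hS)
    rw [adjCount_self_eq hv hN hS]
    rw [ha0] at hNa
    rw [hNd, he] at hNR
    rw [hNd, he, hm]
    obtain ⟨y, rfl⟩ : ∃ y, x = y + 1 := ⟨x - 1, by omega⟩
    nlinarith [Nat.zero_le (y * e)]
  rcases Nat.lt_or_ge x 2 with hx2 | hx2
  · obtain ⟨t, ht, hut⟩ := degIn_pos_iff.1 (ha ▸ ha0)
    have := adjCount_le_of_tight hG hclosed hv hp hN hS hNd (by omega) hu ht hut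
    have hdm : d = m := by omega
    subst hdm
    omega
  · obtain ⟨r, hr⟩ : ∃ r, x = r + a := ⟨x - a, by omega⟩
    have hSS := adjCount_nonneighbors_le (p := 2 * i + 1) hG hp hvu hS ha.symm (r := r) (by omega)
    have hi : 2 * ((2 * i + 1) / 2) = 2 * i := by omega
    rw [adjCount_self_eq hv hN hS]
    rw [hNd, he] at hNR hNa
    rw [hi] at hSS
    rw [hNd, he, hm]
    obtain ⟨b, rfl⟩ : ∃ b, a = b + 1 := ⟨a - 1, by omega⟩
    rw [Nat.add_sub_cancel] at hSS
    subst hr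
    -- the bound holds with slack `(d - 2) * (2 * x - 2 - a)`
    obtain ⟨c, hc⟩ : ∃ c, 2 * r + b = c + 1 := ⟨2 * r + b - 1, by omega⟩
    have hec : e * (2 * r + b) = e * c + e := by rw [hc]; ring
    have hec0 : 0 ≤ e * c := Nat.zero_le _
    linarith

end UpperBound

/-! ### Extremal graphs -/

section Constructions

lemma degIn_le_of_embedding {V W : Type*} [Fintype V] [Fintype W] {G : SimpleGraph V}
    {H : SimpleGraph W} (f : G ↪g H) (a : V) : degIn G univ a ≤ degIn H univ (f a) := by
  classical
  refine Finset.card_le_card_of_injOn f (fun b hb => ?_) f.injective.injOn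
  simpa using hb

/-- There is a graph on `n` vertices without isolated vertices and with at least `e / 2` edges
whose total domination needs at least `t` vertices. -/
def Realizable (t n e : ℕ) : Prop :=
  ∃ (V : Type) (_ : Fintype V) (H : SimpleGraph V), Fintype.card V = n ∧
    (∀ v, ∃ u, H.Adj v u) ∧ NeedsDominators H univ t ∧ e ≤ adjCount H univ univ

/-- Adding a disjoint edge raises the number of dominators by two. -/
lemma Realizable.add_edge {t n e : ℕ} (h : Realizable t n e) :
    Realizable (t + 2) (n + 2) (e + 2) := by
  classical
  obtain ⟨V, _, H, hV, hH, ht, he⟩ := h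
  refine ⟨V ⊕ Bool, inferInstance, H ⊕g (⊤ : SimpleGraph Bool), by simp [hV], ?_, ?_, ?_⟩
  · rintro (v | b)
    · obtain ⟨u, hu⟩ := hH v
      exact ⟨Sum.inl u, by simpa using hu⟩
    · exact ⟨Sum.inr (!b), by simp⟩
  · intro D hD
    have h1 : t ≤ #D.toLeft := ht _ fun v _ => by
      obtain ⟨y | y, hy, hvy⟩ := hD (Sum.inl v) (Finset.mem_univ _)
      · exact ⟨y, by simpa using hy, by simpa using hvy⟩
      · simp at hvy
    have h2 : D.toRight = univ := by
      ext b
      obtain ⟨y | y, hy, hby⟩ := hD (Sum.inr (!b)) (Finset.mem_univ _)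
      · simp at hby
      · have : y = b := by revert hby; cases b <;> cases y <;> simp
        simpa [← this] using hy
    have h3 := Finset.card_toLeft_add_card_toRight (u := D)
    rw [h2, Finset.card_univ, Fintype.card_bool] at h3
    omega
  · have h1 : adjCount H univ univ ≤
        ∑ v : V, degIn (H ⊕g (⊤ : SimpleGraph Bool)) univ (Sum.inl v) :=
      Finset.sum_le_sum fun v _ =>
        degIn_le_of_embedding (SimpleGraph.Embedding.sumInl (G := H) (H := ⊤)) v
    have h2 : ∀ b : Bool, 1 ≤ degIn (H ⊕g (⊤ : SimpleGraph Bool)) univ (Sum.inr b) := fun b =>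
      degIn_pos_iff.2 ⟨Sum.inr (!b), Finset.mem_univ _, by simp⟩
    have h3 := h2 true
    have h4 := h2 false
    rw [adjCount, Fintype.sum_sum_type, Fintype.sum_bool]
    omega

lemma Realizable.add_edges {t n e : ℕ} (h : Realizable t n e) (l : ℕ) :
    Realizable (t + 2 * l) (n + 2 * l) (e + 2 * l) := by
  induction l with
  | zero => exact h
  | succ l ih => exact ih.add_edge

lemma needsDominators_two {V : Type*} [Fintype V] [Nonempty V] (G : SimpleGraph V) :
    NeedsDominators G univ 2 := by
  classical
  intro D hD
  obtain ⟨y, hy, -⟩ := hD (Classical.arbitrary V) (Finset.mem_univ _)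
  obtain ⟨z, hz, hyz⟩ := hD y (Finset.mem_univ _)
  exact Finset.one_lt_card.2 ⟨y, hy, z, hz, hyz.ne⟩

lemma degIn_top {V : Type*} [Fintype V] (a : V) :
    degIn (⊤ : SimpleGraph V) univ a = Fintype.card V - 1 := by
  classical
  unfold degIn
  rw [← Finset.card_univ, ← Finset.card_erase_of_mem (Finset.mem_univ a)]
  congr 1
  ext b
  simp [eq_comm]

lemma realizable_complete (r : ℕ) : Realizable 2 (r + 2) (r * (r + 3) + 2) := by
  refine ⟨Fin (r + 2), inferInstance, ⊤, by simp, fun v => ?_, needsDominators_two _, ?_⟩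
  · obtain ⟨u, hu⟩ := exists_ne v
    exact ⟨u, by simpa using hu.symm⟩
  · simp only [adjCount, degIn_top, Fintype.card_fin, Finset.sum_const, Finset.card_univ,
      smul_eq_mul, Nat.add_succ_sub_one]
    exact le_of_eq (by ring)

/-- The adjacency relation of the 5-cycle `inl - 0 - 1 - 2 - 3 - inl` whose vertex `inl` is
replaced by a clique with vertex set `C`. -/
def cycleCliqueAdj {C : Type*} : C ⊕ Fin 4 → C ⊕ Fin 4 → Prop
  | Sum.inl a, Sum.inl b => a ≠ b
  | Sum.inl _, Sum.inr j => j = 0 ∨ j = 3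
  | Sum.inr i, Sum.inl _ => i = 0 ∨ i = 3
  | Sum.inr i, Sum.inr j => i.val + 1 = j.val ∨ j.val + 1 = i.val

/-- A 5-cycle in which one vertex is replaced by a clique with vertex set `C`. -/
def cycleClique (C : Type*) : SimpleGraph (C ⊕ Fin 4) where
  Adj := cycleCliqueAdj
  symm := ⟨by
    rintro (a | i) (b | j) h
    · exact Ne.symm h
    · exact h
    · exact h
    · exact Or.symm h⟩
  loopless := ⟨by
    rintro (a | i) h
    · exact h rfl
    · rcases h with h | h <;> omega⟩

lemma realizable_cycleClique (s : ℕ) :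
    Realizable 3 (s + 5) (s * s + 5 * s + 10) := by
  classical
  have hll : ∀ a b : Fin (s + 1),
      (cycleClique (Fin (s + 1))).Adj (Sum.inl a) (Sum.inl b) ↔ a ≠ b := fun _ _ => Iff.rfl
  have hlr : ∀ (a : Fin (s + 1)) (j : Fin 4),
      (cycleClique (Fin (s + 1))).Adj (Sum.inl a) (Sum.inr j) ↔ j = 0 ∨ j = 3 :=
    fun _ _ => Iff.rfl
  have hrl : ∀ (a : Fin (s + 1)) (j : Fin 4),
      (cycleClique (Fin (s + 1))).Adj (Sum.inr j) (Sum.inl a) ↔ j = 0 ∨ j = 3 :=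
    fun _ _ => Iff.rfl
  have hrr : ∀ i j : Fin 4, (cycleClique (Fin (s + 1))).Adj (Sum.inr i) (Sum.inr j) ↔
      i.val + 1 = j.val ∨ j.val + 1 = i.val := fun _ _ => Iff.rfl
  refine ⟨Fin (s + 1) ⊕ Fin 4, inferInstance, cycleClique _, by simp, ?_, ?_, ?_⟩
  · rintro (a | i)
    · exact ⟨Sum.inr 0, by simp [hlr]⟩
    · fin_cases i
      · exact ⟨Sum.inr 1, by simp [hrr]⟩
      · exact ⟨Sum.inr 0, by simp [hrr]⟩
      · exact ⟨Sum.inr 3, by simp [hrr]⟩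
      · exact ⟨Sum.inr 2, by simp [hrr]⟩
  · intro D hD
    -- `D` meets the neighbourhood of each cycle vertex `0`, `1`, `2`, `3` and of the clique; no
    -- two vertices do that
    have h1 : Sum.inr 0 ∈ D ∨ Sum.inr 2 ∈ D := by
      obtain ⟨y | j, hy, hadj⟩ := hD (Sum.inr 1) (Finset.mem_univ _)
      · simp [hrl] at hadj
      · fin_cases j <;> simp [hrr] at hadj hy <;> simp [hy]
    have h2 : Sum.inr 1 ∈ D ∨ Sum.inr 3 ∈ D := by
      obtain ⟨y | j, hy, hadj⟩ := hD (Sum.inr 2) (Finset.mem_univ _)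
      · simp [hrl] at hadj
      · fin_cases j <;> simp [hrr] at hadj hy <;> simp [hy]
    have h0 : (∃ a, Sum.inl a ∈ D) ∨ Sum.inr 1 ∈ D := by
      obtain ⟨y | j, hy, hadj⟩ := hD (Sum.inr 0) (Finset.mem_univ _)
      · exact Or.inl ⟨y, hy⟩
      · fin_cases j <;> simp [hrr] at hadj hy
        simp [hy]
    have h3 : (∃ a, Sum.inl a ∈ D) ∨ Sum.inr 2 ∈ D := by
      obtain ⟨y | j, hy, hadj⟩ := hD (Sum.inr 3) (Finset.mem_univ _)
      · exact Or.inl ⟨y, hy⟩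
      · fin_cases j <;> simp [hrr] at hadj hy
        simp [hy]
    have h4 : (∃ a, Sum.inl a ∈ D) ∨ Sum.inr 0 ∈ D ∨ Sum.inr 3 ∈ D := by
      obtain ⟨y | j, hy, hadj⟩ := hD (Sum.inl 0) (Finset.mem_univ _)
      · exact Or.inl ⟨y, hy⟩
      · fin_cases j <;> simp [hlr] at hadj hy <;> simp [hy]
    have three : ∀ x y z : Fin (s + 1) ⊕ Fin 4, x ∈ D → y ∈ D → z ∈ D → x ≠ y → x ≠ z → y ≠ z →
        3 ≤ #D := fun x y z hx hy hz hxy hxz hyz =>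
      Finset.two_lt_card.2 ⟨x, hx, y, hy, z, hz, hxy, hxz, hyz⟩
    by_cases hl : ∃ a, Sum.inl a ∈ D
    · obtain ⟨a, ha⟩ := hl
      rcases h1 with h1 | h1 <;> rcases h2 with h2 | h2 <;>
        exact three _ _ _ ha h1 h2 (by simp) (by simp) (by simp)
    · simp only [hl, false_or] at h0 h3 h4
      rcases h4 with h4 | h4 <;>
        exact three _ _ _ h0 h3 h4 (by simp) (by simp) (by simp)
  · have h1 : ∀ a : Fin (s + 1), s + 2 ≤ degIn (cycleClique (Fin (s + 1))) univ (Sum.inl a) := by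
      intro a
      have hsub : ({x ∈ (univ : Finset (Fin (s + 1))) | a ≠ x}.disjSum {0, 3} :
          Finset (Fin (s + 1) ⊕ Fin 4)) ⊆
          {b ∈ (univ : Finset (Fin (s + 1) ⊕ Fin 4)) |
            (cycleClique (Fin (s + 1))).Adj (Sum.inl a) b} := by
        rintro (b | j) hb
        · simpa [hll] using hb
        · simpa [hlr] using hb
      have := Finset.card_le_card hsub
      rw [Finset.card_disjSum, Finset.filter_ne, Finset.card_erase_of_mem (Finset.mem_univ _),
        Finset.card_univ, Fintype.card_fin] at this
      exact this
    have h2 : ∀ j : Fin 4, (j = 0 ∨ j = 3) →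
        s + 2 ≤ degIn (cycleClique (Fin (s + 1))) univ (Sum.inr j) := by
      intro j hj
      obtain ⟨i, hi⟩ : ∃ i, (cycleClique (Fin (s + 1))).Adj (Sum.inr j) (Sum.inr i) := by
        rcases hj with rfl | rfl
        exacts [⟨1, by simp [hrr]⟩, ⟨2, by simp [hrr]⟩]
      have hsub : ((univ : Finset (Fin (s + 1))).disjSum {i} : Finset (Fin (s + 1) ⊕ Fin 4)) ⊆
          {b ∈ (univ : Finset (Fin (s + 1) ⊕ Fin 4)) |
            (cycleClique (Fin (s + 1))).Adj (Sum.inr j) b} := by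
        rintro (b | j') hb
        · simpa [hrl] using hj
        · simp only [Finset.inr_mem_disjSum, Finset.mem_singleton] at hb
          simpa [hb] using hi
      have := Finset.card_le_card hsub
      rw [Finset.card_disjSum, Finset.card_univ, Fintype.card_fin, Finset.card_singleton] at this
      exact this
    have h3 : 2 ≤ degIn (cycleClique (Fin (s + 1))) univ (Sum.inr 1) :=
      one_lt_degIn (b := Sum.inr 0) (c := Sum.inr 2) (Finset.mem_univ _) (Finset.mem_univ _)
        (by simp) (by simp [hrr]) (by simp [hrr])
    have h4 : 2 ≤ degIn (cycleClique (Fin (s + 1))) univ (Sum.inr 2) :=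
      one_lt_degIn (b := Sum.inr 1) (c := Sum.inr 3) (Finset.mem_univ _) (Finset.mem_univ _)
        (by simp) (by simp [hrr]) (by simp [hrr])
    have h5 := h2 0 (Or.inl rfl)
    have h6 := h2 3 (Or.inr rfl)
    have h7 := Finset.card_nsmul_le_sum univ
      (fun a => degIn (cycleClique (Fin (s + 1))) univ (Sum.inl a)) (s + 2) fun a _ => h1 a
    rw [Finset.card_univ, Fintype.card_fin, smul_eq_mul] at h7
    rw [adjCount, Fintype.sum_sum_type, Fin.sum_univ_four]
    linarith

end Constructions

/-! ### Bondage numbers of complete graphs -/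

section Bondage

lemma noIsolatedVertices_iff {V : Type*} {G : SimpleGraph V} :
    NoIsolatedVertices G ↔ ∀ v, ∃ u, G.Adj v u := by
  simp [NoIsolatedVertices, SimpleGraph.IsIsolated]

lemma le_totalDominationNumber_iff {V : Type*} [Fintype V] {G : SimpleGraph V}
    (hG : ∀ v, ∃ u, G.Adj v u) {t : ℕ} :
    t ≤ totalDominationNumber G ↔ NeedsDominators G univ t := by
  constructor
  · intro h D hD
    exact h.trans (Nat.sInf_le ⟨D, fun v => hD v (Finset.mem_univ v), rfl⟩)
  · intro h
    refine le_csInf ⟨_, univ, fun v => ?_, rfl⟩ ?_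
    · obtain ⟨u, hu⟩ := hG v
      exact ⟨u, Finset.mem_univ u, hu⟩
    · rintro _ ⟨S, hS, rfl⟩
      exact h S fun w _ => hS w

lemma totalDominationNumber_top {n : ℕ} (hn : 2 ≤ n) :
    totalDominationNumber (⊤ : SimpleGraph (Fin n)) = 2 := by
  obtain ⟨m, rfl⟩ : ∃ m, n = m + 2 := ⟨n - 2, by omega⟩
  apply le_antisymm
  · refine Nat.sInf_le ⟨{0, 1}, fun v => ?_, Finset.card_pair (by simp)⟩
    by_cases hv : v = 0
    · exact ⟨1, by simp, by simp [hv]⟩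
    · exact ⟨0, by simp, by simpa using hv⟩
  · rw [le_totalDominationNumber_iff fun v => ?_]
    · exact needsDominators_two _
    · obtain ⟨u, hu⟩ := exists_ne v
      exact ⟨u, by simpa using hu.symm⟩

lemma two_mul_card_add_adjCount_deleteEdges {n : ℕ} {D : Finset (Sym2 (Fin n))}
    (hD : (D : Set (Sym2 (Fin n))) ⊆ (⊤ : SimpleGraph (Fin n)).edgeSet) :
    2 * #D + adjCount ((⊤ : SimpleGraph (Fin n)).deleteEdges D) univ univ = n * (n - 1) := by
  classical
  have h2 : adjCount (⊤ : SimpleGraph (Fin n)) univ univ = n * (n - 1) := by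
    simp [adjCount, degIn_top]
  have hD' : D ⊆ (⊤ : SimpleGraph (Fin n)).edgeFinset := fun e he =>
    SimpleGraph.mem_edgeFinset.2 (hD he)
  have h3 := Finset.card_sdiff_add_card_eq_card hD'
  rw [← SimpleGraph.edgeFinset_deleteEdges] at h3
  rw [← h2, adjCount_univ, adjCount_univ]
  omega

/-- The sizes occurring in the definition of the `k`-total bondage number of a complete graph, in
terms of the graph `H` that remains after deleting edges. -/
lemma mem_kTotalBondageSizes_iff {n k m : ℕ} (hn : 2 ≤ n) :
    m ∈ kTotalBondageSizes (⊤ : SimpleGraph (Fin n)) k ↔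
      ∃ H : SimpleGraph (Fin n), (∀ v, ∃ u, H.Adj v u) ∧ NeedsDominators H univ (2 + k) ∧
        2 * m + adjCount H univ univ = n * (n - 1) := by
  classical
  constructor
  · rintro ⟨D, hD, rfl, hiso, hk⟩
    rw [noIsolatedVertices_iff] at hiso
    rw [totalDominationNumber_top hn, le_totalDominationNumber_iff hiso] at hk
    exact ⟨_, hiso, hk, two_mul_card_add_adjCount_deleteEdges hD⟩
  · rintro ⟨H, hiso, hk, hm⟩
    have hD : ((Hᶜ.edgeFinset : Finset (Sym2 (Fin n))) : Set (Sym2 (Fin n))) ⊆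
        (⊤ : SimpleGraph (Fin n)).edgeSet := by
      rw [SimpleGraph.coe_edgeFinset]
      exact SimpleGraph.edgeSet_mono le_top
    have hH : (⊤ : SimpleGraph (Fin n)).deleteEdges
        (Hᶜ.edgeFinset : Finset (Sym2 (Fin n))) = H := by
      ext a b
      rw [SimpleGraph.coe_edgeFinset]
      simp only [SimpleGraph.deleteEdges_adj, SimpleGraph.top_adj, SimpleGraph.mem_edgeSet,
        SimpleGraph.compl_adj, not_and, not_not]
      exact ⟨fun h => h.2 h.1, fun h => ⟨h.ne, fun _ => h⟩⟩
    have hc := two_mul_card_add_adjCount_deleteEdges hD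
    rw [hH] at hc
    refine ⟨Hᶜ.edgeFinset, hD, by omega, ?_, ?_⟩
    · rwa [hH, noIsolatedVertices_iff]
    · rwa [hH, totalDominationNumber_top hn, le_totalDominationNumber_iff hiso]

/-- If `e / 2` is the largest number of edges of a graph on `n` vertices without isolated vertices
that needs `k + 2` dominators, then the `k`-total bondage number of the complete graph is the
number of remaining edges. -/
lemma two_mul_kTotalBondageNumber {n k e : ℕ} (hn : 2 ≤ n) (hreal : Realizable (2 + k) n e)
    (hmax : ∀ H : SimpleGraph (Fin n), (∀ v, ∃ u, H.Adj v u) → NeedsDominators H univ (2 + k) →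
      adjCount H univ univ ≤ e) :
    (kTotalBondageSizes (⊤ : SimpleGraph (Fin n)) k).Nonempty ∧
      2 * kTotalBondageNumber (⊤ : SimpleGraph (Fin n)) k + e = n * (n - 1) := by
  classical
  obtain ⟨V, _, H₀, hV, hiso, ht, he⟩ := hreal
  let f : Fin n ≃ V := (Fintype.equivFinOfCardEq hV).symm
  have hiso' : ∀ v, ∃ u, (H₀.comap f).Adj v u := fun v => by
    obtain ⟨u, hu⟩ := hiso (f v)
    exact ⟨f.symm u, by simpa using hu⟩
  have ht' : NeedsDominators (H₀.comap f) univ (2 + k) := fun D hD => by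
    have := ht (D.map f.toEmbedding) fun w _ => by
      obtain ⟨y, hy, hwy⟩ := hD (f.symm w) (Finset.mem_univ _)
      exact ⟨f y, by simpa using hy, by simpa using hwy⟩
    simpa using this
  have he' : e ≤ adjCount (H₀.comap f) univ univ := by
    refine he.trans ?_
    unfold adjCount
    rw [← Equiv.sum_comp f.symm]
    exact Finset.sum_le_sum fun v _ =>
      degIn_le_of_embedding (SimpleGraph.Iso.comap f H₀).symm.toEmbedding v
  have hee : adjCount (H₀.comap f) univ univ = e := le_antisymm (hmax _ hiso' ht') he'
  have hmem : ∃ m, 2 * m + e = n * (n - 1) := by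
    obtain ⟨c, hc⟩ := even_adjCount_self (G := H₀.comap f) univ
    obtain ⟨b, hb⟩ := Nat.even_mul_pred_self n
    have h1 := adjCount_self_le (G := H₀.comap f) univ
    rw [Finset.card_univ, Fintype.card_fin] at h1
    exact ⟨b - c, by omega⟩
  obtain ⟨m, hm⟩ := hmem
  have hmS : m ∈ kTotalBondageSizes (⊤ : SimpleGraph (Fin n)) k :=
    (mem_kTotalBondageSizes_iff hn).2 ⟨_, hiso', ht', by rw [hee, hm]⟩
  refine ⟨⟨m, hmS⟩, ?_⟩
  have hle : kTotalBondageNumber (⊤ : SimpleGraph (Fin n)) k ≤ m := Nat.sInf_le hmS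
  obtain ⟨H, h1, h2, h3⟩ := (mem_kTotalBondageSizes_iff hn).1 (Nat.sInf_mem ⟨m, hmS⟩)
  have h4 := hmax H h1 h2
  change 2 * kTotalBondageNumber (⊤ : SimpleGraph (Fin n)) k + _ = _ at h3
  omega

end Bondage

end TotalBondage

theorem mainTheorem1 (n k : ℕ) (hn : 5 ≤ n) :
    (Even k → k + 2 ≤ n →
      (TotalBondage.kTotalBondageSizes (SimpleGraph.completeGraph (Fin n)) k).Nonempty ∧
      (TotalBondage.kTotalBondageNumber (SimpleGraph.completeGraph (Fin n)) k : ℚ) =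
        (n : ℚ) * (k : ℚ) - ((k : ℚ) ^ 2 + 2 * (k : ℚ)) / 2) ∧
    (Odd k → k + 4 ≤ n →
      (TotalBondage.kTotalBondageSizes (SimpleGraph.completeGraph (Fin n)) k).Nonempty ∧
      (TotalBondage.kTotalBondageNumber (SimpleGraph.completeGraph (Fin n)) k : ℚ) =
        (n : ℚ) * (k : ℚ) + (n : ℚ) - ((k : ℚ) ^ 2 + 4 * (k : ℚ) + 5) / 2) := by
  constructor
  · rintro ⟨l, hl⟩ hkn
    obtain ⟨r, hr⟩ : ∃ r, n = r + 2 + 2 * l := ⟨n - 2 - 2 * l, by omega⟩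
    have hk : 2 + k = 2 + 2 * l := by omega
    obtain ⟨h1, h2⟩ := TotalBondage.two_mul_kTotalBondageNumber (n := n) (k := k)
      (e := r * (r + 3) + 2 + 2 * l) (by omega)
      (by rw [hr, hk]; exact (TotalBondage.realizable_complete r).add_edges l)
      fun H hiso hH => by
        have := TotalBondage.adjCount_le_of_needsDominators hiso Finset.univ (2 + k) r
          (by rw [Finset.card_univ, Fintype.card_fin]; omega) hH
        omega
    refine ⟨h1, ?_⟩
    change (TotalBondage.kTotalBondageNumber (⊤ : SimpleGraph (Fin n)) k : ℚ) = _
    generalize TotalBondage.kTotalBondageNumber (⊤ : SimpleGraph (Fin n)) k = b at h2 ⊢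
    have hk' : k = 2 * l := by omega
    have hn1 : n - 1 = r + 1 + 2 * l := by omega
    rw [hn1, hr] at h2
    have h3 : (2 * b + (r * (r + 3) + 2 + 2 * l) : ℚ) = (r + 2 + 2 * l) * (r + 1 + 2 * l) := by
      exact_mod_cast h2
    rw [hr, hk']
    push_cast
    linarith
  · rintro ⟨l, hl⟩ hkn
    obtain ⟨s, hs⟩ : ∃ s, n = s + 5 + 2 * l := ⟨n - 5 - 2 * l, by omega⟩
    have hk : 2 + k = 3 + 2 * l := by omega
    obtain ⟨h1, h2⟩ := TotalBondage.two_mul_kTotalBondageNumber (n := n) (k := k)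
      (e := s * s + 5 * s + 10 + 2 * l) (by omega)
      (by rw [hs, hk]; exact (TotalBondage.realizable_cycleClique s).add_edges l)
      fun H hiso hH => by
        have hk2 : 2 + k = 2 * (l + 1) + 1 := by omega
        rw [hk2] at hH
        have := (TotalBondage.adjCount_le_of_odd hiso Finset.univ (l + 1) (s + 2)
          (fun _ _ y _ => Finset.mem_univ y)
          (by rw [Finset.card_univ, Fintype.card_fin]; omega) hH).2
        linarith
    refine ⟨h1, ?_⟩
    change (TotalBondage.kTotalBondageNumber (⊤ : SimpleGraph (Fin n)) k : ℚ) = _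
    generalize TotalBondage.kTotalBondageNumber (⊤ : SimpleGraph (Fin n)) k = b at h2 ⊢
    have hn1 : n - 1 = s + 4 + 2 * l := by omega
    rw [hn1, hs] at h2
    have h3 : (2 * b + (s * s + 5 * s + 10 + 2 * l) : ℚ) =
        (s + 5 + 2 * l) * (s + 4 + 2 * l) := by
      exact_mod_cast h2
    rw [hs, hl]
    push_cast
    linarith
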